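/- Let $R$ be an associative ring with unity. A homomorphism $f\colon A\to B$ of left $R$-modules is an \emph{RD-embedding} if it is injective and $f[A]\cap rB=r f[A]$ for every $r\in R$. Then the class of RD-embeddings is cofibrantly generated in the category of left $R$-modules: there is a set $I$ of homomorphisms of left $R$-modules such that the RD-embeddings are exactly the retracts (in the category of arrows) of transfinite compositions of pushouts of morphisms in $I$. -/

import Mathlib

open CategoryTheory
open scoped Pointwise

/-- An `R`-linear map `f : A → B` of left `R`-modules is an RD-embedding if it is injective
and `f[A] ∩ rB = r f[A]` for every `r ∈ R`. -/
def LinearMap.IsRDEmbedding {R A B : Type*} [Ring R] [AddCommGroup A] [Module R A]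
    [AddCommGroup B] [Module R B] (f : A →ₗ[R] B) : Prop :=
  Function.Injective f ∧
    ∀ r : R, Set.range f ∩ r • (Set.univ : Set B) = r • Set.range f

universe u v

/-- The class of RD-embeddings in the category of left `R`-modules. -/
def rdEmbeddings (R : Type u) [Ring R] : MorphismProperty (ModuleCat.{v} R) :=
  fun _ _ f => f.hom.IsRDEmbedding

/-- `cof(I)`: the retracts, in the category of arrows, of transfinite compositions (indexed by
well-ordered types in `Type u`) of pushouts of morphisms in `I`. -/
def CategoryTheory.MorphismProperty.cof {C : Type v} [Category.{u} C]
    (I : MorphismProperty C) : MorphismProperty C :=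
  (MorphismProperty.transfiniteCompositions.{u} I.pushouts).retracts

/-- A class of morphisms `W` is cofibrantly generated if `W = cof(I)` for a set `I` of
morphisms. -/
def CategoryTheory.MorphismProperty.IsCofibrantlyGenerated {C : Type v} [Category.{u} C]
    (W : MorphismProperty C) : Prop :=
  ∃ I : MorphismProperty C, MorphismProperty.IsSmall.{u} I ∧ W = I.cof

/-!
A linear map `f : A → B` is an RD-embedding iff it reflects divisibility: whenever `f a` is divisible
by `r` in `B`, already `a` is divisible by `r` in `A` (`LinearMap.isRDEmbedding_iff`).

In other words, all the maps `A / rA → B / rB` are injective. Since `ℚ/ℤ` is an injective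
cogenerator of abelian groups, this means that every character of `A` that kills `rA` extends to a
character of `B` that kills `rB`. Such characters are the linear maps into the character module
`RDCharacter r` of the right module `R / rR`, so RD-embeddings are the class with the left lifting
property against the maps `RDCharacter r → 0` (`rdEmbeddings_eq_llp`). A class of this form is stable
under pushouts, transfinite compositions and retracts.

Conversely, let `A` be a proper relatively divisible submodule of `B`, and let `b ∈ B` lie outside
`A`. Choose for each `r` solutions of the solvable equations `r • n = r • x` with `n ∈ A` (where
`r • x ∈ A`), and of the solvable equations `r • x = y` modulo `A`. A submodule `C` that contains `b`
and is closed under these choices has the property that `A ∩ C → C` is an RD-embedding, and that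
`A + C` is relatively divisible in `B`; and `A → A + C` is a pushout of `A ∩ C → C`
(`Submodule.IsRelativelyDivisible.exists_gt`). No cardinal arithmetic is needed to bound `C`: the
values of the formal expressions `ClosureTerm R (R ⊕ R)` at `b` form such a `C`, which is therefore a
quotient of one fixed free module. Hence the RD-embeddings of submodules into quotients of this free
module form a generating set, `generatingRDEmbeddings`. As relatively divisible submodules are closed
under directed unions, transfinite iteration of the enlargement exhausts `B`
(`rdEmbeddings_le_transfiniteCompositions`), so that not even retracts are needed.
-/

/-! ### Relative divisibility elementwise -/

namespace LinearMap

variable {R A B : Type*} [Ring R] [AddCommGroup A] [Module R A] [AddCommGroup B] [Module R B]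

/-- An RD-embedding is a map that reflects divisibility by each ring element; injectivity is the
case `r = 0`. -/
lemma isRDEmbedding_iff {f : A →ₗ[R] B} :
    f.IsRDEmbedding ↔ ∀ (r : R) (a : A) (b : B), f a = r • b → ∃ a', a = r • a' := by
  constructor
  · rintro ⟨hf, h⟩ r a b hab
    have : f a ∈ r • Set.range f :=
      h r ▸ ⟨⟨a, rfl⟩, Set.mem_smul_set.2 ⟨b, trivial, hab.symm⟩⟩
    obtain ⟨_, ⟨a', rfl⟩, ha'⟩ := Set.mem_smul_set.1 this
    exact ⟨a', hf (by rw [← ha', map_smul])⟩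
  · intro h
    refine ⟨(injective_iff_map_eq_zero f).2 fun a ha ↦ ?_, fun r ↦ ?_⟩
    · obtain ⟨a', rfl⟩ := h 0 a 0 (by rw [ha, zero_smul])
      exact zero_smul R a'
    · ext b
      simp only [Set.mem_inter_iff, Set.mem_smul_set, Set.mem_univ, true_and, Set.mem_range,
        exists_exists_eq_and]
      constructor
      · rintro ⟨⟨a, rfl⟩, b, hb⟩
        obtain ⟨a', rfl⟩ := h r a b hb.symm
        exact ⟨a', (map_smul f r a').symm⟩
      · rintro ⟨a, rfl⟩
        exact ⟨⟨r • a, map_smul f r a⟩, f a, rfl⟩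

end LinearMap

namespace Submodule

variable {R B : Type*} [Ring R] [AddCommGroup B] [Module R B]

/-- A submodule `N` of `B` is relatively divisible if every element of `N` divisible by `r` in `B`
is divisible by `r` in `N`. -/
def IsRelativelyDivisible (N : Submodule R B) : Prop :=
  ∀ (r : R) (b : B), r • b ∈ N → ∃ n ∈ N, r • b = r • n

lemma isRelativelyDivisible_range {A : Type*} [AddCommGroup A] [Module R A] {f : A →ₗ[R] B}
    (hf : f.IsRDEmbedding) : (LinearMap.range f).IsRelativelyDivisible := by
  rintro r b ⟨a, ha⟩
  obtain ⟨a', rfl⟩ := LinearMap.isRDEmbedding_iff.1 hf r a b ha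
  exact ⟨f a', ⟨a', rfl⟩, by rw [← ha, map_smul]⟩

lemma isRelativelyDivisible_iSup {ι : Sort*} [Nonempty ι] {N : ι → Submodule R B}
    (hN : Directed (· ≤ ·) N) (h : ∀ i, (N i).IsRelativelyDivisible) :
    (⨆ i, N i).IsRelativelyDivisible := by
  intro r b hb
  obtain ⟨i, hi⟩ := (mem_iSup_of_directed N hN).1 hb
  obtain ⟨n, hn, e⟩ := h i r b hi
  exact ⟨n, le_iSup N i hn, e⟩

end Submodule

/-! ### RD-embeddings as a class with a left lifting property -/

/-- A character of an abelian group that vanishes on the kernel of a homomorphism extends along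
it, as `ℚ/ℤ` is injective. -/
lemma CharacterModule.exists_comp_eq {A C : Type*} [AddCommGroup A] [AddCommGroup C]
    (g : A →+ C) (ψ : A →+ AddCircle (1 : ℚ)) (h : g.ker ≤ ψ.ker) :
    ∃ χ : C →+ AddCircle (1 : ℚ), χ.comp g = ψ := by
  obtain ⟨χ, hχ⟩ := CharacterModule.dual_surjective_of_injective
    (QuotientAddGroup.kerLift g).toIntLinearMap (QuotientAddGroup.kerLift_injective g)
    (QuotientAddGroup.lift g.ker ψ h)
  refine ⟨χ, ?_⟩
  ext a
  exact DFunLike.congr_fun hχ (QuotientAddGroup.mk a)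

section Characters

variable {R : Type u} [Ring R]

/-- The character group of the right module `R / rR`, realised as the group of the characters of
`R` that vanish on `rR`. -/
def RDCharacter (r : R) : AddSubgroup (R →+ AddCircle (1 : ℚ)) where
  carrier := {χ | ∀ s, χ (r * s) = 0}
  add_mem' hχ hχ' s := by simp [hχ s, hχ' s]
  zero_mem' _ := rfl
  neg_mem' hχ s := by simp [hχ s]

namespace RDCharacter

/-- The left module structure dual to the right multiplication on `R / rR`. -/
instance (r : R) : Module R (RDCharacter r) where
  smul t χ := ⟨χ.1.comp (AddMonoidHom.mulRight t), fun s ↦ by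
    simpa [mul_assoc] using χ.2 (s * t)⟩
  one_smul χ := Subtype.ext <| AddMonoidHom.ext fun s ↦ congrArg χ.1 (mul_one s)
  mul_smul t t' χ := Subtype.ext <| AddMonoidHom.ext fun s ↦
    congrArg χ.1 (mul_assoc s t t').symm
  smul_zero _ := rfl
  smul_add _ _ _ := rfl
  add_smul t t' χ := Subtype.ext <| AddMonoidHom.ext fun s ↦
    (congrArg χ.1 (mul_add s t t')).trans (map_add χ.1 _ _)
  zero_smul χ := Subtype.ext <| AddMonoidHom.ext fun s ↦
    (congrArg χ.1 (mul_zero s)).trans (map_zero χ.1)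

lemma smul_apply {r : R} (t : R) (χ : RDCharacter r) (s : R) : (t • χ).1 s = χ.1 (s * t) := rfl

variable {A : Type*} [AddCommGroup A] [Module R A]

/-- The linear map to `RDCharacter r` that corresponds, by the tensor-hom adjunction, to a
character vanishing on `rA`. -/
def ofCharacter (r : R) (ψ : A →+ AddCircle (1 : ℚ)) (hψ : ∀ a, ψ (r • a) = 0) :
    A →ₗ[R] RDCharacter r where
  toFun a := ⟨ψ.comp ((AddMonoidHom.flip (smulAddHom R A)) a), fun s ↦ by
    simpa [mul_smul] using hψ (s • a)⟩
  map_add' a a' := Subtype.ext <| AddMonoidHom.ext fun s ↦ by simp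
  map_smul' t a := Subtype.ext <| AddMonoidHom.ext fun s ↦ by simp [smul_apply, mul_smul]

lemma ofCharacter_apply (r : R) (ψ : A →+ AddCircle (1 : ℚ)) (hψ : ∀ a, ψ (r • a) = 0)
    (a : A) (s : R) : (ofCharacter r ψ hψ a).1 s = ψ (s • a) := rfl

/-- The character vanishing on `rA` that corresponds to a linear map to `RDCharacter r`. -/
def toCharacter {r : R} (g : A →ₗ[R] RDCharacter r) : A →+ AddCircle (1 : ℚ) where
  toFun a := (g a).1 1
  map_zero' := by simp
  map_add' a a' := by simp

lemma toCharacter_smul {r : R} (g : A →ₗ[R] RDCharacter r) (s : R) (a : A) :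
    toCharacter g (s • a) = (g a).1 s := by
  change (g (s • a)).1 1 = _
  rw [map_smul, smul_apply, one_mul]

lemma toCharacter_smul_self {r : R} (g : A →ₗ[R] RDCharacter r) (a : A) :
    toCharacter g (r • a) = 0 := by
  rw [toCharacter_smul]
  simpa using (g a).2 1

end RDCharacter

variable {A B : Type*} [AddCommGroup A] [Module R A] [AddCommGroup B] [Module R B]

/-- A map is an RD-embedding iff it induces injections `A / rA → B / rB`, which the characters of
these groups detect. -/
lemma LinearMap.isRDEmbedding_iff_forall_exists_comp_eq {f : A →ₗ[R] B} :
    f.IsRDEmbedding ↔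
      ∀ (r : R) (g : A →ₗ[R] RDCharacter r), ∃ h : B →ₗ[R] RDCharacter r, h ∘ₗ f = g := by
  rw [isRDEmbedding_iff]
  constructor
  · intro H r g
    let q := QuotientAddGroup.mk' (smulAddHom R B r).range
    obtain ⟨χ, hχ⟩ := CharacterModule.exists_comp_eq (q.comp f.toAddMonoidHom)
      (RDCharacter.toCharacter g) (by
        intro a ha
        have : f a ∈ (smulAddHom R B r).range := (QuotientAddGroup.eq_zero_iff _).1 ha
        obtain ⟨b, hb⟩ := this
        obtain ⟨a', rfl⟩ := H r a b hb.symm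
        exact RDCharacter.toCharacter_smul_self g a')
    refine ⟨RDCharacter.ofCharacter r (χ.comp q) fun b ↦ ?_, ?_⟩
    · have : q (r • b) = 0 := (QuotientAddGroup.eq_zero_iff _).2 ⟨b, rfl⟩
      rw [AddMonoidHom.comp_apply, this, map_zero]
    · refine LinearMap.ext fun a ↦ Subtype.ext <| AddMonoidHom.ext fun s ↦ ?_
      rw [LinearMap.comp_apply, RDCharacter.ofCharacter_apply, ← map_smul,
        ← RDCharacter.toCharacter_smul, ← hχ]
      rfl
  · intro H r a b hab
    by_contra ha
    let q := QuotientAddGroup.mk' (smulAddHom R A r).range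
    have hqa : q a ≠ 0 := fun h ↦ by
      obtain ⟨a', ha'⟩ := (QuotientAddGroup.eq_zero_iff _).1 h
      exact ha ⟨a', ha'.symm⟩
    obtain ⟨c, hc⟩ := CharacterModule.exists_character_apply_ne_zero_of_ne_zero hqa
    let ψ : A →+ AddCircle (1 : ℚ) := AddMonoidHom.comp c q
    have hψ (a : A) : ψ (r • a) = 0 := by
      have : q (r • a) = 0 := (QuotientAddGroup.eq_zero_iff _).2 ⟨a, rfl⟩
      exact (congrArg c this).trans (map_zero c)
    obtain ⟨h, hh⟩ := H r (RDCharacter.ofCharacter r ψ hψ)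
    have e : (h (f a)).1 1 = ψ ((1 : R) • a) := by
      rw [← RDCharacter.ofCharacter_apply r ψ hψ, ← hh]
      rfl
    rw [one_smul R a, hab, map_smul, RDCharacter.smul_apply, one_mul] at e
    exact hc (e.symm.trans (by simpa using (h b).2 1))

end Characters

/-- RD-embeddings are the maps with the left lifting property against the maps from the
modules `RDCharacter r` to zero. -/
lemma rdEmbeddings_eq_llp (R : Type u) [Ring R] :
    rdEmbeddings.{u, u} R = (MorphismProperty.ofHoms fun r : R ↦
      (0 : ModuleCat.of R (RDCharacter r) ⟶ ModuleCat.of R PUnit.{u + 1})).llp := by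
  ext A B f
  refine LinearMap.isRDEmbedding_iff_forall_exists_comp_eq.trans ⟨?_, ?_⟩
  · rintro H _ _ _ ⟨r⟩
    refine ⟨fun {g _} sq ↦ ?_⟩
    obtain ⟨h, hh⟩ := H r g.hom
    exact ⟨⟨⟨ModuleCat.ofHom h, ModuleCat.hom_ext hh, by ext⟩⟩⟩
  · intro H r g
    have := H _ (MorphismProperty.ofHoms.mk r)
    have sq : CommSq (ModuleCat.ofHom g) f
        (0 : ModuleCat.of R (RDCharacter r) ⟶ ModuleCat.of R PUnit.{u + 1}) 0 := ⟨by simp⟩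
    exact ⟨sq.lift.hom, congrArg ModuleCat.Hom.hom sq.fac_left⟩

lemma cof_le_rdEmbeddings {R : Type u} [Ring R] {I : MorphismProperty (ModuleCat.{u} R)}
    (hI : I ≤ rdEmbeddings.{u, u} R) : I.cof ≤ rdEmbeddings.{u, u} R := by
  rw [rdEmbeddings_eq_llp] at hI ⊢
  have h₁ := (MorphismProperty.pushouts_monotone hI).trans
    (MorphismProperty.pushouts_le (P := (MorphismProperty.ofHoms _).llp))
  have h₂ := (MorphismProperty.transfiniteCompositions_monotone.{u} h₁).trans
    (MorphismProperty.transfiniteCompositions_le _)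
  exact (MorphismProperty.retracts_monotone h₂).trans (MorphismProperty.retracts_le _)

/-! ### Small submodules closed under operations -/

/-- Formal expressions in one generator, built by addition, scalar multiplication, and unary
operations indexed by `ι`. -/
inductive ClosureTerm (R ι : Type*)
  | base : ClosureTerm R ι
  | add (s t : ClosureTerm R ι) : ClosureTerm R ι
  | smul (r : R) (t : ClosureTerm R ι) : ClosureTerm R ι
  | op (i : ι) (t : ClosureTerm R ι) : ClosureTerm R ι

namespace ClosureTerm

variable {R ι B : Type*} [Ring R] [AddCommGroup B] [Module R B]

/-- The value in a module of a formal expression, given the generator and the operations. -/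
def eval (b : B) (g : ι → B → B) : ClosureTerm R ι → B
  | base => b
  | add s t => s.eval b g + t.eval b g
  | smul r t => r • t.eval b g
  | op i t => g i (t.eval b g)

/-- Every element of a module lies in a submodule closed under the given operations that is
isomorphic to a quotient of one fixed free module, which depends on neither the module nor the
operations. -/
lemma exists_injective_linearMap (b : B) (g : ι → B → B) :
    ∃ (K : Submodule R (ClosureTerm R ι →₀ R)) (φ : ((ClosureTerm R ι →₀ R) ⧸ K) →ₗ[R] B),
      Function.Injective φ ∧ b ∈ LinearMap.range φ ∧
        ∀ i, ∀ x ∈ LinearMap.range φ, g i x ∈ LinearMap.range φ := by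
  let S : Submodule R B :=
    { carrier := Set.range (eval (R := R) b g)
      add_mem' := by
        rintro _ _ ⟨s, rfl⟩ ⟨t, rfl⟩
        exact ⟨add s t, rfl⟩
      zero_mem' := ⟨smul 0 base, zero_smul R b⟩
      smul_mem' := by
        rintro r _ ⟨t, rfl⟩
        exact ⟨smul r t, rfl⟩ }
  let ψ : (ClosureTerm R ι →₀ R) →ₗ[R] B := Finsupp.linearCombination R (eval b g)
  let φ := (LinearMap.ker ψ).liftQ ψ le_rfl
  have hφ : LinearMap.range φ = S := by
    rw [Submodule.range_liftQ, Finsupp.range_linearCombination]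
    exact Submodule.span_eq S
  refine ⟨_, φ, LinearMap.ker_eq_bot.1 (Submodule.ker_liftQ_eq_bot' _ _ rfl), ?_, ?_⟩
  · rw [hφ]
    exact ⟨base, rfl⟩
  · rw [hφ]
    rintro i _ ⟨t, rfl⟩
    exact ⟨op i t, rfl⟩

end ClosureTerm

/-! ### Pushouts and directed unions of submodules -/

section

variable {R : Type*} [Ring R]

/-- A linear map factors through a surjection that kills no more than it does. -/
lemma LinearMap.exists_comp_eq_of_ker_le {M N P : Type*} [AddCommGroup M] [Module R M]
    [AddCommGroup N] [Module R N] [AddCommGroup P] [Module R P] {q : M →ₗ[R] N}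
    (hq : Function.Surjective q) {f : M →ₗ[R] P} (h : LinearMap.ker q ≤ LinearMap.ker f) :
    ∃ d : N →ₗ[R] P, d ∘ₗ q = f := by
  refine ⟨(LinearMap.ker q).liftQ f h ∘ₗ (q.quotKerEquivOfSurjective hq).symm.toLinearMap, ?_⟩
  ext m
  have : (q.quotKerEquivOfSurjective hq).symm (q m) = Submodule.Quotient.mk m := by
    rw [LinearEquiv.symm_apply_eq]
    rfl
  simp [this]

/-- Linear maps on a directed family of submodules that are compatible glue on the union. -/
lemma Submodule.exists_linearMap_iSup {B P J : Type*} [AddCommGroup B] [Module R B]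
    [AddCommGroup P] [Module R P] [Preorder J] [IsDirectedOrder J] [Nonempty J]
    {N : J → Submodule R B} (hN : Monotone N) {T : Submodule R B} (hT : T = ⨆ j, N j)
    (f : ∀ j, N j →ₗ[R] P) (hf : ∀ i j (h : i ≤ j), f j ∘ₗ inclusion (hN h) = f i) :
    ∃ d : T →ₗ[R] P, ∀ j (x : B) (hx : x ∈ N j) (hx' : x ∈ T), d ⟨x, hx'⟩ = f j ⟨x, hx⟩ := by
  have hmem (x : T) : ∃ j, x.1 ∈ N j := (mem_iSup_of_directed _ hN.directed_le).1 (hT ▸ x.2)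
  choose k hk using hmem
  have indep (j j' : J) (x : B) (hx : x ∈ N j) (hx' : x ∈ N j') :
      f j ⟨x, hx⟩ = f j' ⟨x, hx'⟩ := by
    obtain ⟨l, h, h'⟩ := exists_ge_ge j j'
    rw [← hf j l h, ← hf j' l h']
    rfl
  refine ⟨⟨⟨fun x ↦ f (k x) ⟨x, hk x⟩, fun x y ↦ ?_⟩, fun r x ↦ ?_⟩,
    fun j x hx hx' ↦ indep _ j x _ hx⟩
  · obtain ⟨l, h, h'⟩ := exists_ge_ge (k x) (k y)
    have hx := hN h (hk x)
    have hy := hN h' (hk y)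
    refine (indep (k (x + y)) l (x + y) (hk (x + y)) (add_mem hx hy)).trans ?_
    rw [indep _ l x _ hx, indep _ l y _ hy, ← map_add]
    rfl
  · exact (indep (k (r • x)) (k x) (r • x) (hk (r • x)) (smul_mem _ r (hk x))).trans
      (map_smul (f (k x)) r ⟨x, hk x⟩)

end

section Submodules

variable {R : Type u} [Ring R] {B : Type v} [AddCommGroup B] [Module R B]

/-- The functor that sends a submodule to its underlying module and an inequality to the
inclusion. -/
def Submodule.toModuleCat (R : Type u) [Ring R] (B : Type v) [AddCommGroup B] [Module R B] :
    Submodule R B ⥤ ModuleCat.{v} R where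
  obj N := ModuleCat.of R N
  map f := ModuleCat.ofHom (Submodule.inclusion f.le)

/-- The square formed by the preimage of a submodule `A` under `φ`, and by the sum of `A` and the
image of `φ`, is a pushout. -/
lemma Submodule.isPushout_comap_sup_range (A : Submodule R B) {M : Type v} [AddCommGroup M]
    [Module R M] (φ : M →ₗ[R] B) :
    IsPushout (ModuleCat.ofHom (φ.restrict (p := A.comap φ) (q := A) fun _ h ↦ h))
      (ModuleCat.ofHom (A.comap φ).subtype)
      ((toModuleCat R B).map (homOfLE (le_sup_left : A ≤ A ⊔ LinearMap.range φ)))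
      (ModuleCat.ofHom (φ.codRestrict (A ⊔ LinearMap.range φ)
        fun m ↦ mem_sup_right ⟨m, rfl⟩)) := by
  let i := inclusion (le_sup_left : A ≤ A ⊔ LinearMap.range φ)
  let j := φ.codRestrict (A ⊔ LinearMap.range φ) fun m ↦ mem_sup_right ⟨m, rfl⟩
  have hq : Function.Surjective (i.coprod j) := by
    rintro ⟨x, hx⟩
    obtain ⟨a, ha, _, ⟨m, rfl⟩, rfl⟩ := mem_sup.1 hx
    exact ⟨(⟨a, ha⟩, m), rfl⟩
  have key (s : Limits.PushoutCocone
      (ModuleCat.ofHom (φ.restrict (p := A.comap φ) (q := A) fun _ h ↦ h))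
      (ModuleCat.ofHom (A.comap φ).subtype)) :
      ∃ d, d ∘ₗ i.coprod j = s.inl.hom.coprod s.inr.hom := by
    refine LinearMap.exists_comp_eq_of_ker_le hq ?_
    rintro ⟨⟨a, ha⟩, m⟩ h
    have h' : a + φ m = 0 := congrArg Subtype.val h
    have hm : -m ∈ A.comap φ := by
      rw [mem_comap, map_neg, ← eq_neg_of_add_eq_zero_left h']
      exact ha
    have e₁ : φ.restrict (p := A.comap φ) (q := A) (fun _ h ↦ h) ⟨-m, hm⟩ = ⟨a, ha⟩ :=
      Subtype.ext ((map_neg φ m).trans (eq_neg_of_add_eq_zero_left h').symm)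
    have e₂ : s.inl.hom ⟨a, ha⟩ = s.inr.hom (-m) := by
      rw [← e₁]
      exact LinearMap.congr_fun (congrArg ModuleCat.Hom.hom s.condition) ⟨-m, hm⟩
    change s.inl.hom ⟨a, ha⟩ + s.inr.hom m = 0
    rw [e₂, map_neg, neg_add_cancel]
  choose d hd using key
  refine ⟨⟨rfl⟩, ⟨Limits.PushoutCocone.IsColimit.mk _ (fun s ↦ ModuleCat.ofHom (d s))
    (fun s ↦ ModuleCat.hom_ext ?_) (fun s ↦ ModuleCat.hom_ext ?_)
    (fun s t h₁ h₂ ↦ ModuleCat.hom_ext ?_)⟩⟩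
  · change d s ∘ₗ i = _
    rw [← LinearMap.coprod_inl i j, ← LinearMap.comp_assoc, hd, LinearMap.coprod_inl]
  · change d s ∘ₗ j = _
    rw [← LinearMap.coprod_inr i j, ← LinearMap.comp_assoc, hd, LinearMap.coprod_inr]
  · refine LinearMap.ext fun x ↦ ?_
    obtain ⟨⟨a, m⟩, rfl⟩ := hq x
    refine Eq.trans ?_ (LinearMap.congr_fun (hd s) (a, m)).symm
    have e₁ : t.hom (i a) = s.inl.hom a := LinearMap.congr_fun (congrArg ModuleCat.Hom.hom h₁) a
    have e₂ : t.hom (j m) = s.inr.hom m := LinearMap.congr_fun (congrArg ModuleCat.Hom.hom h₂) m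
    exact (map_add t.hom (i a) (j m)).trans (congrArg₂ (· + ·) e₁ e₂)

/-- The union of a directed family of submodules is its colimit. -/
lemma Submodule.nonempty_isColimit_mapCocone {J : Type*} [Preorder J] [IsDirectedOrder J]
    [Nonempty J] (F : J ⥤ Submodule R B) (c : Limits.Cocone F) (hc : c.pt = ⨆ j, F.obj j) :
    Nonempty (Limits.IsColimit ((toModuleCat R B).mapCocone c)) := by
  let f (s : Limits.Cocone (F ⋙ toModuleCat R B)) (j : J) : F.obj j →ₗ[R] s.pt :=
    (s.ι.app j).hom
  have key (s : Limits.Cocone (F ⋙ toModuleCat R B)) :=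
    exists_linearMap_iSup F.monotone hc (f s)
      fun i j h ↦ congrArg ModuleCat.Hom.hom (s.w (homOfLE h))
  choose d hd using key
  refine ⟨{ desc s := ModuleCat.ofHom (d s), fac s j := ?_, uniq s m hm := ?_ }⟩
  · ext x
    exact hd s j x.1 x.2 _
  · refine ModuleCat.hom_ext (LinearMap.ext fun ⟨x, hx⟩ ↦ ?_)
    obtain ⟨j, hj⟩ := (mem_iSup_of_directed _ F.monotone.directed_le).1 (hc ▸ hx)
    exact (LinearMap.congr_fun (congrArg ModuleCat.Hom.hom (hm j)) ⟨x, hj⟩).trans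
      (hd s j x hj hx).symm

end Submodules

/-! ### The generating set -/

section Generating

variable (R : Type u) [Ring R]

/-- The RD-embeddings of submodules into quotients of one fixed free module, whose basis consists
of the expressions with two families of unary operations indexed by `R`. -/
def generatingRDEmbeddings : MorphismProperty (ModuleCat.{u} R) :=
  MorphismProperty.ofHoms
    fun p : Σ K : Submodule R (ClosureTerm R (R ⊕ R) →₀ R),
      {N : Submodule R ((ClosureTerm R (R ⊕ R) →₀ R) ⧸ K) // N.subtype.IsRDEmbedding} ↦
    (ModuleCat.ofHom p.2.1.subtype :
      ModuleCat.of R p.2.1 ⟶ ModuleCat.of R ((ClosureTerm R (R ⊕ R) →₀ R) ⧸ p.1))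

instance : MorphismProperty.IsSmall.{u} (generatingRDEmbeddings R) := by
  unfold generatingRDEmbeddings
  infer_instance

lemma generatingRDEmbeddings_le : generatingRDEmbeddings R ≤ rdEmbeddings.{u, u} R := by
  rintro _ _ _ ⟨p⟩
  exact p.2.2

variable {R} in
lemma generatingRDEmbeddings_subtype {K : Submodule R (ClosureTerm R (R ⊕ R) →₀ R)}
    {N : Submodule R (_ ⧸ K)} (hN : N.subtype.IsRDEmbedding) :
    generatingRDEmbeddings R (ModuleCat.ofHom N.subtype) :=
  MorphismProperty.ofHoms.mk (⟨K, N, hN⟩ : Σ K : Submodule R (ClosureTerm R (R ⊕ R) →₀ R),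
    {N : Submodule R (_ ⧸ K) // N.subtype.IsRDEmbedding})

end Generating

namespace Submodule

variable {R : Type u} [Ring R] {B : Type u} [AddCommGroup B] [Module R B]

/-- A proper relatively divisible submodule can be enlarged, relatively divisibly, along a pushout
of a generating RD-embedding. -/
lemma IsRelativelyDivisible.exists_gt {A : Submodule R B} (hA : A.IsRelativelyDivisible)
    (hA' : A ≠ ⊤) :
    ∃ (A' : Submodule R B) (h : A < A'), A'.IsRelativelyDivisible ∧
      (generatingRDEmbeddings R).pushouts ((toModuleCat R B).map (homOfLE h.le)) := by
  classical
  obtain ⟨b, -, hb⟩ := SetLike.exists_of_lt hA'.lt_top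
  -- Closure under `u` makes the preimage of `A` relatively divisible: if `r • x` lies in `A`, then
  -- `u r x` is an element of `A` with `r • x = r • u r x`.
  have hu (r : R) (x : B) : ∃ y, r • x ∈ A → y ∈ A ∧ r • x = r • y := by
    by_cases h : r • x ∈ A
    · obtain ⟨n, hn⟩ := hA r x h
      exact ⟨n, fun _ ↦ hn⟩
    · exact ⟨0, fun h' ↦ (h h').elim⟩
  -- Closure under `w` makes the sum with `A` relatively divisible: `w r y` solves `r • x = y`
  -- modulo `A` whenever this is possible.
  have hw (r : R) (y : B) : ∃ x, (∃ x', r • x' - y ∈ A) → r • x - y ∈ A := by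
    by_cases h : ∃ x', r • x' - y ∈ A
    · exact ⟨h.choose, fun _ ↦ h.choose_spec⟩
    · exact ⟨0, fun h' ↦ (h h').elim⟩
  choose u hu using hu
  choose w hw using hw
  obtain ⟨K, φ, hφ, ⟨m, rfl⟩, hcl⟩ :=
    ClosureTerm.exists_injective_linearMap (R := R) b (Sum.elim u w)
  refine ⟨A ⊔ LinearMap.range φ, ?_, ?_, ?_⟩
  · exact left_lt_sup.2 fun h ↦ hb (h ⟨m, rfl⟩)
  · intro r x hx
    obtain ⟨a, ha, y, hy, e⟩ := mem_sup.1 hx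
    have hw' : r • w r y - y ∈ A := hw r y ⟨x, by rwa [← e, add_sub_cancel_right]⟩
    have : r • (x - w r y) ∈ A := by
      have h := sub_mem ha hw'
      rwa [eq_sub_of_add_eq e, sub_sub_sub_cancel_right, ← smul_sub] at h
    obtain ⟨n, hn, hn'⟩ := hA r _ this
    refine ⟨n + w r y, add_mem (mem_sup_left hn) (mem_sup_right (hcl (.inr r) y hy)), ?_⟩
    rw [smul_add, ← hn', smul_sub, sub_add_cancel]
  · refine MorphismProperty.pushouts_mk _ (A.isPushout_comap_sup_range φ)
      (generatingRDEmbeddings_subtype (LinearMap.isRDEmbedding_iff.2 ?_))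
    rintro r ⟨_, hn⟩ y rfl
    have hy : r • φ y ∈ A := by rwa [← map_smul]
    obtain ⟨h₁, h₂⟩ := hu r (φ y) hy
    obtain ⟨n, hn'⟩ := hcl (.inl r) (φ y) ⟨y, rfl⟩
    replace hn' : φ n = u r (φ y) := hn'
    refine ⟨⟨n, by rwa [mem_comap, hn']⟩, Subtype.ext (hφ ?_)⟩
    change φ (r • y) = φ (r • n)
    rw [map_smul, map_smul, hn', h₂]

/-! ### Exhausting a module by relatively divisible submodules -/

open scoped Classical in
/-- An enlargement of a proper relatively divisible submodule along a pushout of a generating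
RD-embedding; other submodules are sent to the whole module. -/
noncomputable def rdEnlargement (A : Submodule R B) : Submodule R B :=
  if h : A.IsRelativelyDivisible ∧ A ≠ ⊤ then (h.1.exists_gt h.2).choose else ⊤

lemma rdEnlargement_top : rdEnlargement (⊤ : Submodule R B) = ⊤ :=
  dif_neg fun h ↦ h.2 rfl

lemma lt_rdEnlargement (A : Submodule R B) (hA : A ≠ ⊤) : A < rdEnlargement A := by
  unfold rdEnlargement
  split_ifs with h
  · exact (h.1.exists_gt h.2).choose_spec.choose
  · exact hA.lt_top

lemma le_rdEnlargement (A : Submodule R B) : A ≤ rdEnlargement A := by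
  by_cases hA : A = ⊤
  · rw [hA, rdEnlargement_top]
  · exact (lt_rdEnlargement A hA).le

lemma isRelativelyDivisible_rdEnlargement (A : Submodule R B) :
    A.rdEnlargement.IsRelativelyDivisible := by
  unfold rdEnlargement
  split_ifs with h
  · exact (h.1.exists_gt h.2).choose_spec.choose_spec.1
  · exact fun r b _ ↦ ⟨b, trivial, rfl⟩

lemma IsRelativelyDivisible.pushouts_map {A A' : Submodule R B} (hA : A.IsRelativelyDivisible)
    (hA' : A ≠ ⊤) (e : A' = A.rdEnlargement) (f : A ⟶ A') :
    (generatingRDEmbeddings R).pushouts ((toModuleCat R B).map f) := by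
  have e' : A' = (hA.exists_gt hA').choose := e.trans (dif_pos ⟨hA, hA'⟩)
  subst e'
  exact (hA.exists_gt hA').choose_spec.choose_spec.2

section Iterate

variable (A : Submodule R B) (J : Type u) [LinearOrder J] [OrderBot J] [SuccOrder J]
  [WellFoundedLT J]

/-- The transfinite iteration of `Submodule.rdEnlargement`, starting at `A`, as a functor. -/
noncomputable def rdIterate : J ⥤ Submodule R B :=
  (monotone_transfiniteIterate rdEnlargement A le_rdEnlargement (J := J)).functor

variable {J}

lemma rdIterate_obj (j : J) :
    (rdIterate A J).obj j = transfiniteIterate rdEnlargement j A := rfl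

instance : (rdIterate A J ⋙ toModuleCat R B).IsWellOrderContinuous where
  nonempty_isColimit m hm := by
    have := hm.nonempty_Iio.to_subtype
    exact nonempty_isColimit_mapCocone _ ((Set.principalSegIio m).cocone (rdIterate A J))
      (transfiniteIterate_limit rdEnlargement A m hm)

lemma IsRelativelyDivisible.rdIterate {A : Submodule R B} (hA : A.IsRelativelyDivisible) (j : J) :
    ((rdIterate A J).obj j).IsRelativelyDivisible := by
  induction j using SuccOrder.limitRecOn with
  | isMin j hj =>
    rwa [hj.eq_bot, rdIterate_obj, transfiniteIterate_bot]
  | succ j hj _ =>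
    rw [rdIterate_obj, transfiniteIterate_succ _ _ _ hj]
    exact isRelativelyDivisible_rdEnlargement _
  | isSuccLimit j hj ih =>
    have := hj.nonempty_Iio.to_subtype
    rw [rdIterate_obj, transfiniteIterate_limit _ _ _ hj]
    exact isRelativelyDivisible_iSup
      (((Submodule.rdIterate A J).monotone.comp (Subtype.mono_coe _)).directed_le) fun i ↦ ih i i.2

/-- If the iteration reaches the whole module first at `j`, then the inclusion of its start in its
`j`-th stage is a transfinite composition of pushouts of generating RD-embeddings. -/
noncomputable def transfiniteCompositionOfShapeRDIterate (hA : A.IsRelativelyDivisible) (j : J)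
    (hj : ∀ k < j, (rdIterate A J).obj k ≠ ⊤) :
    (generatingRDEmbeddings R).pushouts.TransfiniteCompositionOfShape (Set.Iic j)
      ((rdIterate A J ⋙ toModuleCat R B).map (homOfLE bot_le : ⊥ ⟶ j)) where
  F := (Set.initialSegIic j).monotone.functor ⋙ rdIterate A J ⋙ toModuleCat R B
  isoBot := Iso.refl _
  incl :=
    { app k := (rdIterate A J ⋙ toModuleCat R B).map (homOfLE k.2)
      naturality _ _ _ := rfl }
  isColimit := Limits.colimitOfDiagramTerminal Limits.isTerminalTop _
  fac := rfl
  map_mem k hk := by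
    have hk' : k.1 < j := lt_of_le_of_ne k.2 fun h ↦ hk fun l _ ↦ l.2.trans h.ge
    refine (hA.rdIterate k.1).pushouts_map (hj _ hk') ?_
      ((rdIterate A J).map (homOfLE (Order.le_succ k)))
    have hs : ((Order.succ k : Set.Iic j) : J) = Order.succ k.1 :=
      Set.Iic.coe_succ_of_not_isMax hk
    change (rdIterate A J).obj ((Order.succ k : Set.Iic j) : J) = _
    rw [hs]
    exact transfiniteIterate_succ _ _ _ (not_isMax_of_lt hk')

end Iterate

end Submodule

lemma rdEmbeddings_le_transfiniteCompositions (R : Type u) [Ring R] :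
    rdEmbeddings.{u, u} R ≤
      MorphismProperty.transfiniteCompositions.{u} (generatingRDEmbeddings R).pushouts := by
  intro X Y f hf
  let A := LinearMap.range f.hom
  have hA : A.IsRelativelyDivisible := Submodule.isRelativelyDivisible_range hf
  -- The iteration is indexed by a well-order too long for it to be injective.
  let κ := Order.succ (Cardinal.mk (Submodule R Y))
  have : Nonempty κ.ord.ToType := by simp [κ]
  have := WellFoundedLT.toOrderBot κ.ord.ToType
  obtain ⟨j₀, hj₀⟩ : ∃ j : κ.ord.ToType, (Submodule.rdIterate A _).obj j = ⊤ := by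
    refine top_mem_range_transfiniteIterate _ A Submodule.lt_rdEnlargement
      Submodule.rdEnlargement_top fun h ↦ ?_
    have := Cardinal.mk_le_of_injective h
    rw [Cardinal.mk_ord_toType] at this
    exact (Order.lt_succ _).not_ge this
  -- Stopping at the first stage that is the whole module makes every earlier stage proper, so that
  -- each step is an enlargement.
  obtain ⟨j, hj, hmin⟩ := WellFounded.has_min wellFounded_lt
    {j : κ.ord.ToType | (Submodule.rdIterate A _).obj j = ⊤} ⟨j₀, hj₀⟩
  let c := A.transfiniteCompositionOfShapeRDIterate hA j fun k hk h ↦ hmin k h hk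
  refine MorphismProperty.transfiniteCompositionsOfShape_le_transfiniteCompositions _ (Set.Iic j) _
    ⟨c.ofArrowIso ?_⟩
  have hbot : A = (Submodule.rdIterate A κ.ord.ToType).obj ⊥ := (transfiniteIterate_bot _ A).symm
  exact (Arrow.isoMk
    ((LinearEquiv.ofInjective f.hom hf.1).trans (LinearEquiv.ofEq _ _ hbot)).toModuleIso
    (LinearEquiv.ofTop _ hj).symm.toModuleIso rfl).symm

theorem mainTheorem5 (R : Type u) [Ring R] :
    (rdEmbeddings.{u, u} R).IsCofibrantlyGenerated :=
  ⟨generatingRDEmbeddings R, inferInstance, le_antisymm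
    ((rdEmbeddings_le_transfiniteCompositions R).trans (MorphismProperty.le_retracts _))
    (cof_le_rdEmbeddings (generatingRDEmbeddings_le R))⟩
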